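/- Let $\Omega$ be a compact topological space with a $\sigma$-algebra $\mathcal A$ containing the open sets (for instance a compact Radon measure space), let $X$ be a real Banach space, let $cb(X)$ be the family of nonempty, closed, bounded, convex subsets of $X$, and let $d_H$ be the Hausdorff distance. Measures are finite non-negative measures on $\mathcal A$. A *gauge* is a map $\Delta$ assigning to every $t\in\Omega$ an open set $\Delta(t)\ni t$. A *partition* is a finite family $\{(A_i,t_i)\}_{i\le p}$ where the $A_i\in\mathcal A$ are disjoint with union $\Omega$ and $t_i\in\Omega$; it is *subordinated* to $\Delta$ if $A_i\subset\Delta(t_i)$ for all $i$. A multifunction $\Gamma:\Omega\to cb(X)$ is *$m$-McShane integrable* with integral $(MS)\int_\Omega\Gamma\,dm=I\in cb(X)$ if for every $\varepsilon>0$ there is a gauge $\Delta$ such that $d_H\bigl(I,\sum_{i\le p}\Gamma(t_i)\,m(A_i)\bigr)<\varepsilon$ for every partition subordinated to $\Delta$ (the sum being a Minkowski sum). For $A\in\mathcal A$, *$m$-McShane integrability of $\Gamma$ on $A$* and $(MS)\int_A\Gamma\,dm$ mean integrability and the integral over $\Omega$ with respect to the measure $E\mapsto m(E\cap A)$, so that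 the relevant sums are $\sum_i\Gamma(t_i)\,m(A_i\cap A)$. For a sequence $(m_n)_n$ of measures, a sequence $(\Gamma_n)_n$ of $m_n$-McShane integrable multifunctions is *$(m_n)$-equi-integrable* if for every $\varepsilon>0$ there is a gauge $\Delta$ such that, for every $n$ and every partition subordinated to $\Delta$, $d_H\bigl(\sum_i\Gamma_n(t_i)\,m_n(A_i),(MS)\int_\Omega\Gamma_n\,dm_n\bigr)<\varepsilon$. **Theorem 3.13.** Let $m$ and $(m_n)_n$ be measures, let $\Gamma_n:\Omega\to cb(X)$ be $m_n$-McShane integrable for every $n\in\mathbb N$, and let $\Gamma:\Omega\to cb(X)$. Suppose that (i) $(\Gamma_n)_n$ is $(m_n)$-equi-integrable on $\Omega$; (ii) $\lim_{n\to\infty}d_H(\Gamma_n(t),\Gamma(t))=0$ for every $t\in\Omega$; (iii) $(m_n)_n$ converges setwise to $m$, that is, $m_n(A)\to m(A)$ for every $A\in\mathcal A$. Then $\Gamma$ is $m$-McShane integrable on $\Omega$ and, for every $A\in\mathcal A$, all the $\Gamma_n$ are $m_n$-McShane integrable on $A$, $\Gamma$ is $m$-McShane integrable on $A$, and $$\lim_{n\to\infty}d_H\Bigl((MS)\int_A\Gamma_n\,dm_n,\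 (MS)\int_A\Gamma\,dm\Bigr)=0 .$$ Moreover, if (iii) is replaced by convergence in total variation, $|m_n-m|(\Omega)\to0$, then the same conclusions hold and the last limit is uniform in $A\in\mathcal A$. -/

import Mathlib

open MeasureTheory Filter Topology
open scoped Pointwise

noncomputable section

namespace McShane

/-- `cb(X)`: the nonempty, closed, bounded, convex subsets of a real normed space `X`. -/
structure ClosedBoundedConvex (X : Type*) [NormedAddCommGroup X] [NormedSpace ℝ X] where
  carrier : Set X
  nonempty' : carrier.Nonempty
  isClosed' : IsClosed carrier
  isBounded' : Bornology.IsBounded carrier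
  convex' : Convex ℝ carrier

instance {X : Type*} [NormedAddCommGroup X] [NormedSpace ℝ X] :
    CoeOut (ClosedBoundedConvex X) (Set X) :=
  ⟨ClosedBoundedConvex.carrier⟩

instance {X : Type*} [NormedAddCommGroup X] [NormedSpace ℝ X] :
    Inhabited (ClosedBoundedConvex X) :=
  ⟨⟨{0}, Set.singleton_nonempty 0, isClosed_singleton, Bornology.isBounded_singleton,
    convex_singleton 0⟩⟩

/-- A gauge on `Ω`: a choice of an open neighbourhood `Δ t ∋ t` of every point `t`. -/
structure Gauge (Ω : Type*) [TopologicalSpace Ω] where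
  toFun : Ω → Set Ω
  isOpen' : ∀ t, IsOpen (toFun t)
  mem' : ∀ t, t ∈ toFun t

/-- A finite strict generalized McShane partition of `Ω`: a finite disjoint cover of `Ω` by
measurable sets `part i`, each with a tag `tag i ∈ Ω` (which need not belong to `part i`). -/
structure Partition (Ω : Type*) [MeasurableSpace Ω] where
  size : ℕ
  part : Fin size → Set Ω
  tag : Fin size → Ω
  measurable' : ∀ i, MeasurableSet (part i)
  disjoint' : Pairwise fun i j => Disjoint (part i) (part j)
  cover' : ⋃ i, part i = Set.univ

/-- The partition `P` is subordinated to the gauge `Δ`. -/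
def Partition.Subordinate {Ω : Type*} [TopologicalSpace Ω] [MeasurableSpace Ω]
    (P : Partition Ω) (Δ : Gauge Ω) : Prop :=
  ∀ i, P.part i ⊆ Δ.toFun (P.tag i)

/-- The McShane sum `∑ i, m (A i) • Γ (t i)` (Minkowski sum and dilation of sets). -/
def mcShaneSum {Ω X : Type*} [MeasurableSpace Ω] [NormedAddCommGroup X] [NormedSpace ℝ X]
    (Γ : Ω → ClosedBoundedConvex X) (m : Measure Ω) (P : Partition Ω) : Set X :=
  ∑ i, m.real (P.part i) • (Γ (P.tag i) : Set X)

/-- `I ∈ cb(X)` is a McShane integral over `Ω` of the multifunction `Γ` with respect to `m`. -/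
def HasMcShaneIntegral {Ω X : Type*} [TopologicalSpace Ω] [MeasurableSpace Ω]
    [NormedAddCommGroup X] [NormedSpace ℝ X]
    (Γ : Ω → ClosedBoundedConvex X) (m : Measure Ω) (I : ClosedBoundedConvex X) : Prop :=
  ∀ ε : ℝ, 0 < ε → ∃ Δ : Gauge Ω, ∀ P : Partition Ω, P.Subordinate Δ →
    Metric.hausdorffDist (I : Set X) (mcShaneSum Γ m P) < ε

/-- `Γ` is `m`-McShane integrable on `Ω`. -/
def McShaneIntegrable {Ω X : Type*} [TopologicalSpace Ω] [MeasurableSpace Ω]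
    [NormedAddCommGroup X] [NormedSpace ℝ X]
    (Γ : Ω → ClosedBoundedConvex X) (m : Measure Ω) : Prop :=
  ∃ I : ClosedBoundedConvex X, HasMcShaneIntegral Γ m I

open Classical in
/-- The McShane integral over `Ω` of `Γ` with respect to `m`
(the junk value `{0}` when `Γ` is not integrable). -/
def mcShaneIntegral {Ω X : Type*} [TopologicalSpace Ω] [MeasurableSpace Ω]
    [NormedAddCommGroup X] [NormedSpace ℝ X]
    (Γ : Ω → ClosedBoundedConvex X) (m : Measure Ω) : ClosedBoundedConvex X :=
  if h : McShaneIntegrable Γ m then h.choose else default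

/-- `Γ` is `m`-McShane integrable on the set `A`: it is integrable with respect to the measure
`E ↦ m (E ∩ A)`, that is, the sums `∑ i, m (A i ∩ A) • Γ (t i)` converge. -/
def McShaneIntegrableOn {Ω X : Type*} [TopologicalSpace Ω] [MeasurableSpace Ω]
    [NormedAddCommGroup X] [NormedSpace ℝ X]
    (Γ : Ω → ClosedBoundedConvex X) (A : Set Ω) (m : Measure Ω) : Prop :=
  McShaneIntegrable Γ (m.restrict A)

/-- The McShane integral of `Γ` over the set `A` with respect to `m`. -/
def mcShaneIntegralOn {Ω X : Type*} [TopologicalSpace Ω] [MeasurableSpace Ω]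
    [NormedAddCommGroup X] [NormedSpace ℝ X]
    (Γ : Ω → ClosedBoundedConvex X) (A : Set Ω) (m : Measure Ω) : ClosedBoundedConvex X :=
  mcShaneIntegral Γ (m.restrict A)

/-- A sequence `Γ n` of `m n`-McShane integrable multifunctions is `(m n)`-equi-integrable: for
every `ε` one gauge serves all the indices `n`. -/
def EquiIntegrable {Ω X : Type*} [TopologicalSpace Ω] [MeasurableSpace Ω]
    [NormedAddCommGroup X] [NormedSpace ℝ X]
    (Γ : ℕ → Ω → ClosedBoundedConvex X) (m : ℕ → Measure Ω) : Prop :=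
  (∀ n, McShaneIntegrable (Γ n) (m n)) ∧
  ∀ ε : ℝ, 0 < ε → ∃ Δ : Gauge Ω, ∀ n, ∀ P : Partition Ω, P.Subordinate Δ →
    Metric.hausdorffDist (mcShaneSum (Γ n) (m n) P) (mcShaneIntegral (Γ n) (m n) : Set X) < ε

/-- Setwise convergence of finite measures. -/
def SetwiseTendsto {Ω : Type*} [MeasurableSpace Ω] (ms : ℕ → Measure Ω) (m : Measure Ω) : Prop :=
  ∀ A : Set Ω, MeasurableSet A → Tendsto (fun n => (ms n).real A) atTop (𝓝 (m.real A))

/-- Convergence in total variation of finite measures: `|m - m n|(Ω) → 0`. -/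
def TotalVariationTendsto {Ω : Type*} [MeasurableSpace Ω] (ms : ℕ → Measure Ω) (m : Measure Ω)
    [∀ n, IsFiniteMeasure (ms n)] [IsFiniteMeasure m] : Prop :=
  Tendsto (fun n =>
    (m.toSignedMeasure - (ms n).toSignedMeasure).totalVariation Set.univ) atTop (𝓝 0)

end McShane

end

/-! Everything rests on a Cauchy estimate uniform in both the index and the set. Given subordinate
`P` and `Q`, keep their parts inside `A` and use the parts of `P` outside `A` for both. The two
glued partitions obey the same gauge, so their sums over `Ω` are close by equi-integrability. These
sums share one bounded Minkowski summand, which can be cancelled between convex sets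
(`hausdorffDist_le_hausdorffDist_add_right`). Hence one gauge controls the sums over every `A` and
every `n` (`EquiIntegrable.exists_gauge`).

For a fixed partition the sums are finite, so they converge as `n → ∞` and the estimate passes to
`Γ` and `m` (`EquiIntegrable.exists_gauge_limit`). Completeness of `X` turns Cauchy estimates into
integrals. Finally, one partition approximates all integrals at once
(`EquiIntegrable.exists_partition`), leaving only the distance between two finite sums, which tends
to zero, uniformly in `A` under total variation. -/

namespace McShane

/-! ### Hausdorff distance and Minkowski operations -/

section HausdorffDist

variable {X : Type*} [NormedAddCommGroup X]

lemma hausdorffDist_le_of_forall_lt {A B : Set X} {r : ℝ} (hr : 0 ≤ r)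
    (h₁ : ∀ δ > 0, ∀ x ∈ A, ∃ y ∈ B, dist x y ≤ r + δ)
    (h₂ : ∀ δ > 0, ∀ y ∈ B, ∃ x ∈ A, dist y x ≤ r + δ) :
    Metric.hausdorffDist A B ≤ r :=
  le_of_forall_pos_le_add fun δ hδ =>
    Metric.hausdorffDist_le_of_mem_dist (by positivity) (h₁ δ hδ) (h₂ δ hδ)

lemma exists_dist_le_hausdorffDist_add {A B : Set X} (hA : A.Nonempty) (hB : B.Nonempty)
    (bA : Bornology.IsBounded A) (bB : Bornology.IsBounded B) {δ : ℝ} (hδ : 0 < δ)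
    {x : X} (hx : x ∈ A) : ∃ y ∈ B, dist x y ≤ Metric.hausdorffDist A B + δ := by
  obtain ⟨y, hy, h⟩ := Metric.exists_dist_lt_of_hausdorffDist_lt hx
    (lt_add_of_pos_right (Metric.hausdorffDist A B) hδ)
    (Metric.hausdorffEDist_ne_top_of_nonempty_of_bounded hA hB bA bB)
  exact ⟨y, hy, h.le⟩

lemma hausdorffDist_add_le {A B C D : Set X} (hA : A.Nonempty) (hB : B.Nonempty)
    (hC : C.Nonempty) (hD : D.Nonempty) (bA : Bornology.IsBounded A) (bB : Bornology.IsBounded B)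
    (bC : Bornology.IsBounded C) (bD : Bornology.IsBounded D) :
    Metric.hausdorffDist (A + C) (B + D) ≤
      Metric.hausdorffDist A B + Metric.hausdorffDist C D := by
  have key : ∀ {A B C D : Set X}, A.Nonempty → B.Nonempty → C.Nonempty → D.Nonempty →
      Bornology.IsBounded A → Bornology.IsBounded B → Bornology.IsBounded C →
      Bornology.IsBounded D → ∀ δ > 0, ∀ x ∈ A + C, ∃ y ∈ B + D,
      dist x y ≤ Metric.hausdorffDist A B + Metric.hausdorffDist C D + δ := by
    intro A B C D hA hB hC hD bA bB bC bD δ hδ x hx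
    obtain ⟨a, ha, c, hc, rfl⟩ := Set.mem_add.1 hx
    obtain ⟨b, hb, hab⟩ := exists_dist_le_hausdorffDist_add hA hB bA bB (half_pos hδ) ha
    obtain ⟨d, hd, hcd⟩ := exists_dist_le_hausdorffDist_add hC hD bC bD (half_pos hδ) hc
    exact ⟨b + d, Set.add_mem_add hb hd, (dist_add_add_le a c b d).trans (by linarith)⟩
  refine hausdorffDist_le_of_forall_lt
    (add_nonneg Metric.hausdorffDist_nonneg Metric.hausdorffDist_nonneg)
    (key hA hB hC hD bA bB bC bD) ?_
  rw [Metric.hausdorffDist_comm (s := A), Metric.hausdorffDist_comm (s := C)]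
  exact key hB hA hD hC bB bA bD bC

variable [NormedSpace ℝ X]

/-- Pass through `r • y`. Only `B` needs a norm bound: it will be a value of the limit
multifunction, so `M` does not depend on `n`. -/
lemma hausdorffDist_smul_le {A B : Set X} (hA : A.Nonempty) (hB : B.Nonempty)
    (bA : Bornology.IsBounded A) (bB : Bornology.IsBounded B) {r s M : ℝ} (hr : 0 ≤ r)
    (hM : ∀ y ∈ B, ‖y‖ ≤ M) :
    Metric.hausdorffDist (r • A) (s • B) ≤ |r - s| * M + r * Metric.hausdorffDist A B := by
  obtain ⟨y₀, hy₀⟩ := hB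
  have hM0 : 0 ≤ M := (norm_nonneg y₀).trans (hM y₀ hy₀)
  have hd : 0 ≤ Metric.hausdorffDist A B := Metric.hausdorffDist_nonneg
  -- Slack `δ / (r + 1)` rather than `δ / r`, since `r` may vanish.
  have key : ∀ δ > 0, ∀ x ∈ A, ∀ y ∈ B, dist x y ≤ Metric.hausdorffDist A B + δ / (r + 1) →
      dist (r • x) (s • y) ≤ |r - s| * M + r * Metric.hausdorffDist A B + δ := by
    intro δ hδ x hx y hy h
    have h1 : dist (r • x) (r • y) = r * dist x y := by
      rw [dist_smul₀, Real.norm_of_nonneg hr]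
    have h2 : dist (r • y) (s • y) = |r - s| * ‖y‖ := by
      rw [dist_eq_norm, ← sub_smul, norm_smul, Real.norm_eq_abs]
    have h3 : r * (δ / (r + 1)) ≤ δ := by
      rw [mul_div_assoc', div_le_iff₀ (by positivity)]
      nlinarith
    calc dist (r • x) (s • y) ≤ r * dist x y + |r - s| * ‖y‖ := by
          rw [← h1, ← h2]; exact dist_triangle _ _ _
      _ ≤ r * (Metric.hausdorffDist A B + δ / (r + 1)) + |r - s| * M := by
          gcongr; exact hM y hy
      _ ≤ _ := by rw [mul_add]; linarith
  refine hausdorffDist_le_of_forall_lt (by positivity) ?_ ?_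
  · rintro δ hδ _ ⟨x, hx, rfl⟩
    obtain ⟨y, hy, h⟩ := exists_dist_le_hausdorffDist_add hA ⟨y₀, hy₀⟩ bA bB
      (δ := δ / (r + 1)) (by positivity) hx
    exact ⟨s • y, Set.smul_mem_smul_set hy, key δ hδ x hx y hy h⟩
  · rintro δ hδ _ ⟨y, hy, rfl⟩
    obtain ⟨x, hx, h⟩ := exists_dist_le_hausdorffDist_add ⟨y₀, hy₀⟩ hA bB bA
      (δ := δ / (r + 1)) (by positivity) hy
    rw [dist_comm, Metric.hausdorffDist_comm] at h
    exact ⟨r • x, Set.smul_mem_smul_set hx, by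
      simpa only [dist_comm] using key δ hδ x hx y hy h⟩

/-- Cancellation of a bounded Minkowski summand, one-sided form. -/
lemma exists_dist_le_of_add_right {A B C : Set X} (hC : C.Nonempty) (bC : Bornology.IsBounded C)
    (cB : Convex ℝ B) {r : ℝ}
    (h : ∀ x ∈ A + C, ∃ y ∈ B + C, dist x y ≤ r) {δ : ℝ} (hδ : 0 < δ) {a : X} (ha : a ∈ A) :
    ∃ b ∈ B, dist a b ≤ r + δ := by
  obtain ⟨c₀, hc₀⟩ := hC
  obtain ⟨D, hD⟩ := Metric.isBounded_iff.1 bC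
  -- Iterate the hypothesis, feeding each `c` back in with the same `a`. The points of `B`
  -- accumulate into an average, which convexity keeps in `B`; after `n + 1` rounds the error is at
  -- most `(n + 1) * r`.
  have step : ∀ n : ℕ, ∃ b ∈ B, ∃ c ∈ C,
      ‖((n + 1 : ℕ) : ℝ) • a + c₀ - ((n + 1 : ℕ) : ℝ) • b - c‖ ≤ ((n + 1 : ℕ) : ℝ) * r := by
    intro n
    induction n with
    | zero =>
      obtain ⟨_, hy, hd⟩ := h _ (Set.add_mem_add ha hc₀)
      obtain ⟨b, hb, c, hc, rfl⟩ := Set.mem_add.1 hy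
      refine ⟨b, hb, c, hc, ?_⟩
      rw [dist_eq_norm] at hd
      simpa [sub_sub] using hd
    | succ n ih =>
      obtain ⟨b, hb, c, hc, hbc⟩ := ih
      obtain ⟨_, hy, hd⟩ := h _ (Set.add_mem_add ha hc)
      obtain ⟨b', hb', c', hc', rfl⟩ := Set.mem_add.1 hy
      rw [dist_eq_norm] at hd
      have hn : (0 : ℝ) < ((n + 1 + 1 : ℕ) : ℝ) := by positivity
      refine ⟨(((n + 1 : ℕ) : ℝ) / ((n + 1 + 1 : ℕ) : ℝ)) • b +
        (1 / ((n + 1 + 1 : ℕ) : ℝ)) • b', cB hb hb' (by positivity) (by positivity) ?_,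
        c', hc', ?_⟩
      · rw [← add_div, div_eq_one_iff_eq hn.ne']; push_cast; ring
      · have e : ((n + 1 + 1 : ℕ) : ℝ) • a + c₀ - ((n + 1 + 1 : ℕ) : ℝ) •
            ((((n + 1 : ℕ) : ℝ) / ((n + 1 + 1 : ℕ) : ℝ)) • b +
              (1 / ((n + 1 + 1 : ℕ) : ℝ)) • b') - c' =
            (((n + 1 : ℕ) : ℝ) • a + c₀ - ((n + 1 : ℕ) : ℝ) • b - c) +
              (a + c - (b' + c')) := by
          rw [smul_add, smul_smul, smul_smul, mul_div_cancel₀ _ hn.ne',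
            mul_div_cancel₀ _ hn.ne']
          push_cast
          module
        rw [e]
        refine (norm_add_le _ _).trans ?_
        push_cast at hbc ⊢
        linarith
  -- Dividing by `n + 1` leaves the error `r` plus `‖c - c₀‖ / (n + 1)`, and the latter is at most
  -- `δ` once `n` exceeds `D / δ`.
  obtain ⟨n, hn⟩ := exists_nat_gt (D / δ)
  obtain ⟨b, hb, c, hc, hbc⟩ := step n
  refine ⟨b, hb, ?_⟩
  have hn' : (0 : ℝ) < ((n + 1 : ℕ) : ℝ) := by positivity
  have h1 : D ≤ ((n + 1 : ℕ) : ℝ) * δ := by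
    rw [div_lt_iff₀ hδ] at hn
    push_cast
    nlinarith
  have h2 : ‖c - c₀‖ ≤ D := by rw [← dist_eq_norm]; exact hD hc hc₀
  have h3 : ((n + 1 : ℕ) : ℝ) * dist a b ≤ ((n + 1 : ℕ) : ℝ) * (r + δ) := by
    have : ((n + 1 : ℕ) : ℝ) * dist a b = ‖((n + 1 : ℕ) : ℝ) • (a - b)‖ := by
      rw [norm_smul, dist_eq_norm, Real.norm_of_nonneg hn'.le]
    rw [this]
    have e : ((n + 1 : ℕ) : ℝ) • (a - b) =
        (((n + 1 : ℕ) : ℝ) • a + c₀ - ((n + 1 : ℕ) : ℝ) • b - c) + (c - c₀) := by module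
    rw [e]
    refine (norm_add_le _ _).trans ?_
    rw [mul_add]
    linarith
  exact le_of_mul_le_mul_left h3 hn'

lemma hausdorffDist_le_hausdorffDist_add_right {A B C : Set X} (hA : A.Nonempty) (hB : B.Nonempty)
    (hC : C.Nonempty) (bA : Bornology.IsBounded A) (bB : Bornology.IsBounded B)
    (bC : Bornology.IsBounded C) (cA : Convex ℝ A) (cB : Convex ℝ B) :
    Metric.hausdorffDist A B ≤ Metric.hausdorffDist (A + C) (B + C) := by
  have key : ∀ {A B : Set X}, A.Nonempty → B.Nonempty → Bornology.IsBounded A →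
      Bornology.IsBounded B → Convex ℝ B → ∀ δ > 0, ∀ x ∈ A, ∃ y ∈ B,
      dist x y ≤ Metric.hausdorffDist (A + C) (B + C) + δ := by
    intro A B hA hB bA bB cB δ hδ x hx
    obtain ⟨y, hy, h⟩ := exists_dist_le_of_add_right hC bC cB
      (fun x hx => exists_dist_le_hausdorffDist_add (hA.add hC) (hB.add hC) (bA.add bC)
        (bB.add bC) (half_pos hδ) hx) (half_pos hδ) hx
    exact ⟨y, hy, h.trans (by linarith)⟩
  refine hausdorffDist_le_of_forall_lt Metric.hausdorffDist_nonneg (key hA hB bA bB cB) ?_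
  rw [Metric.hausdorffDist_comm]
  exact key hB hA bB bA cA

end HausdorffDist

/-! ### The complete pseudometric space of bounded convex sets -/

/-- The nonempty bounded convex (not necessarily closed) subsets of a real normed space. -/
structure BoundedConvex (X : Type*) [NormedAddCommGroup X] [NormedSpace ℝ X] where
  carrier : Set X
  nonempty : carrier.Nonempty
  isBounded : Bornology.IsBounded carrier
  convex : Convex ℝ carrier

section BoundedConvex

variable {X : Type*} [NormedAddCommGroup X] [NormedSpace ℝ X]

lemma BoundedConvex.hausdorffEDist_ne_top (A B : BoundedConvex X) :
    Metric.hausdorffEDist A.carrier B.carrier ≠ ⊤ :=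
  Metric.hausdorffEDist_ne_top_of_nonempty_of_bounded A.nonempty B.nonempty A.isBounded B.isBounded

/-- Only a pseudometric, because Minkowski sums of closed sets need not be closed and a set lies at
distance zero from its closure. -/
noncomputable instance : PseudoMetricSpace (BoundedConvex X) where
  dist A B := Metric.hausdorffDist A.carrier B.carrier
  dist_self _ := Metric.hausdorffDist_self_zero
  dist_comm _ _ := Metric.hausdorffDist_comm
  dist_triangle A B _ := Metric.hausdorffDist_triangle (A.hausdorffEDist_ne_top B)

lemma BoundedConvex.dist_def (A B : BoundedConvex X) :
    dist A B = Metric.hausdorffDist A.carrier B.carrier := rfl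

lemma BoundedConvex.edist_def (A B : BoundedConvex X) :
    edist A B = Metric.hausdorffEDist A.carrier B.carrier := by
  rw [edist_dist, dist_def, Metric.hausdorffDist, ENNReal.ofReal_toReal (A.hausdorffEDist_ne_top B)]

/-- The inclusion of `cb(X)` into the bounded convex sets. -/
def ClosedBoundedConvex.toBoundedConvex (A : ClosedBoundedConvex X) : BoundedConvex X :=
  ⟨A, A.nonempty', A.isBounded', A.convex'⟩

/-- The closure of a bounded convex set, an element of `cb(X)`. -/
def BoundedConvex.closure (A : BoundedConvex X) : ClosedBoundedConvex X :=
  ⟨_root_.closure A.carrier, A.nonempty.closure, isClosed_closure, A.isBounded.closure,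
    A.convex.closure⟩

lemma BoundedConvex.dist_closure (A : BoundedConvex X) : dist A A.closure.toBoundedConvex = 0 :=
  Metric.hausdorffDist_self_closure

/-- Closures form a Cauchy sequence in the complete space `Closeds X`. The limit is nonempty and
bounded, being within distance 1 of some term, and convex because convex combinations can be
approximated through the terms. -/
instance [CompleteSpace X] : CompleteSpace (BoundedConvex X) := by
  refine EMetric.complete_of_cauchySeq_tendsto fun u hu => ?_
  let v : ℕ → TopologicalSpace.Closeds X := fun n => ⟨closure (u n).carrier, isClosed_closure⟩
  have huv : ∀ n k, edist (v n) (v k) = edist (u n) (u k) := fun n k => by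
    rw [BoundedConvex.edist_def, TopologicalSpace.Closeds.edist_eq]
    exact Metric.hausdorffEDist_closure
  have hv : CauchySeq v := by
    rw [EMetric.cauchySeq_iff] at hu ⊢
    simpa only [huv] using hu
  obtain ⟨L, hL⟩ := cauchySeq_tendsto_of_complete hv
  have hL' : ∀ ε > 0, ∃ n, Metric.hausdorffEDist (u n).carrier L < ε := by
    intro ε hε
    obtain ⟨n, hn⟩ := (EMetric.tendsto_atTop.1 hL) ε hε
    refine ⟨n, ?_⟩
    have := hn n le_rfl
    rw [TopologicalSpace.Closeds.edist_eq] at this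
    simpa [v] using this
  obtain ⟨n₁, hn₁⟩ := hL' 1 one_pos
  have hfin := (hn₁.trans ENNReal.one_lt_top).ne
  have hne : (L : Set X).Nonempty := Metric.nonempty_of_hausdorffEDist_ne_top (u n₁).nonempty hfin
  have hbd : Bornology.IsBounded (L : Set X) := by
    refine ((u n₁).isBounded.cthickening (δ := 1)).subset fun x hx => ?_
    rw [Metric.mem_cthickening_iff, ENNReal.ofReal_one]
    exact (Metric.infEDist_le_hausdorffEDist_of_mem hx).trans
      (by rw [Metric.hausdorffEDist_comm]; exact hn₁.le)
  have hcv : Convex ℝ (L : Set X) := by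
    intro x hx y hy a b ha hb hab
    rw [SetLike.mem_coe, ← SetLike.mem_coe, ← L.isClosed.closure_eq, Metric.mem_closure_iff]
    intro ε hε
    obtain ⟨n, hn⟩ := hL' (ENNReal.ofReal (ε / 2)) (by simpa using hε)
    have hn' := hn
    rw [Metric.hausdorffEDist_comm] at hn'
    obtain ⟨x', hx', hxx⟩ := Metric.exists_edist_lt_of_hausdorffEDist_lt hx hn'
    obtain ⟨y', hy', hyy⟩ := Metric.exists_edist_lt_of_hausdorffEDist_lt hy hn'
    obtain ⟨z, hz, hzz⟩ := Metric.exists_edist_lt_of_hausdorffEDist_lt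
      ((u n).convex hx' hy' ha hb hab) hn
    rw [edist_lt_ofReal] at hxx hyy hzz
    refine ⟨z, hz, ?_⟩
    have h1 : dist (a • x + b • y) (a • x' + b • y') ≤ ε / 2 := by
      refine (dist_add_add_le _ _ _ _).trans ?_
      rw [dist_smul₀, dist_smul₀, Real.norm_of_nonneg ha, Real.norm_of_nonneg hb]
      calc a * dist x x' + b * dist y y' ≤ a * (ε / 2) + b * (ε / 2) := by gcongr
        _ = ε / 2 := by rw [← add_mul, hab, one_mul]
    linarith [dist_triangle (a • x + b • y) (a • x' + b • y') z]
  refine ⟨⟨L, hne, hbd, hcv⟩, ?_⟩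
  rw [tendsto_iff_edist_tendsto_0] at hL ⊢
  refine hL.congr fun n => ?_
  rw [BoundedConvex.edist_def, TopologicalSpace.Closeds.edist_eq]
  exact Metric.hausdorffEDist_closure_left

end BoundedConvex

/-! ### Gluing partitions, and the filter of subordinate partitions -/

section Partition

variable {Ω : Type*} [MeasurableSpace Ω]

/-- The partition that agrees with `P` on `A` and with `Q` on the complement of `A`. -/
def Partition.glue (P Q : Partition Ω) {A : Set Ω} (hA : MeasurableSet A) : Partition Ω where
  size := P.size + Q.size
  part := Fin.append (fun i => P.part i ∩ A) (fun j => Q.part j ∩ Aᶜ)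
  tag := Fin.append P.tag Q.tag
  measurable' := Fin.addCases
    (fun i => by simpa using (P.measurable' i).inter hA)
    (fun j => by simpa using (Q.measurable' j).inter hA.compl)
  disjoint' := by
    have hd : ∀ s t : Set Ω, Disjoint (s ∩ A) (t ∩ Aᶜ) := fun s t =>
      disjoint_compl_right.mono Set.inter_subset_right Set.inter_subset_right
    intro i j
    refine Fin.addCases (fun i => ?_) (fun i => ?_) i <;>
      refine Fin.addCases (fun j => ?_) (fun j => ?_) j <;> intro hij <;>
      simp only [Fin.append_left, Fin.append_right]
    · exact (P.disjoint' fun h => hij (by rw [h])).mono Set.inter_subset_left Set.inter_subset_left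
    · exact hd _ _
    · exact (hd _ _).symm
    · exact (Q.disjoint' fun h => hij (by rw [h])).mono Set.inter_subset_left Set.inter_subset_left
  cover' := by
    refine Set.eq_univ_of_forall fun x => Set.mem_iUnion.2 ?_
    by_cases hx : x ∈ A
    · obtain ⟨i, hi⟩ := Set.mem_iUnion.1 (P.cover'.symm ▸ Set.mem_univ x)
      exact ⟨Fin.castAdd _ i, by simpa using ⟨hi, hx⟩⟩
    · obtain ⟨j, hj⟩ := Set.mem_iUnion.1 (Q.cover'.symm ▸ Set.mem_univ x)
      exact ⟨Fin.natAdd _ j, by simpa using ⟨hj, hx⟩⟩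

variable [TopologicalSpace Ω]

lemma Partition.Subordinate.glue {P Q : Partition Ω} {Δ : Gauge Ω} (hP : P.Subordinate Δ)
    (hQ : Q.Subordinate Δ) {A : Set Ω} (hA : MeasurableSet A) :
    (P.glue Q hA).Subordinate Δ := by
  intro i
  refine Fin.addCases (fun i => ?_) (fun i => ?_) i
  · simpa [Partition.glue] using Set.inter_subset_left.trans (hP i)
  · simpa [Partition.glue] using Set.inter_subset_left.trans (hQ i)

instance : Nonempty (Gauge Ω) :=
  ⟨⟨fun _ => Set.univ, fun _ => isOpen_univ, fun _ => Set.mem_univ _⟩⟩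

/-- The pointwise intersection of two gauges. -/
def Gauge.inter (Δ Δ' : Gauge Ω) : Gauge Ω where
  toFun t := Δ.toFun t ∩ Δ'.toFun t
  isOpen' t := (Δ.isOpen' t).inter (Δ'.isOpen' t)
  mem' t := ⟨Δ.mem' t, Δ'.mem' t⟩

/-- Disjointify a finite subcover of the gauge, keeping its tags. This makes `partitionFilter`
proper, so that limits along it are meaningful. -/
lemma exists_subordinate [CompactSpace Ω] [OpensMeasurableSpace Ω] (Δ : Gauge Ω) :
    ∃ P : Partition Ω, P.Subordinate Δ := by
  obtain ⟨s, hs⟩ := isCompact_univ.elim_finite_subcover Δ.toFun Δ.isOpen'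
    (fun t _ => Set.mem_iUnion.2 ⟨t, Δ.mem' t⟩)
  let tag : Fin s.card → Ω := fun i => s.equivFin.symm i
  refine ⟨⟨s.card, disjointed fun i => Δ.toFun (tag i), tag, fun i => ?_, disjoint_disjointed _,
    ?_⟩, fun i => disjointed_subset (fun i => Δ.toFun (tag i)) i⟩
  · exact disjointedRec (fun _ _ ht => ht.diff (Δ.isOpen' _).measurableSet)
      (Δ.isOpen' _).measurableSet
  · rw [iUnion_disjointed]
    refine Set.eq_univ_of_forall fun x => Set.mem_iUnion.2 ?_
    obtain ⟨t, ht, hx⟩ := Set.mem_iUnion₂.1 (hs (Set.mem_univ x))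
    exact ⟨s.equivFin ⟨t, ht⟩, by simpa [tag] using hx⟩

variable (Ω) in
/-- The filter of partitions generated by the sets of partitions subordinated to a gauge. -/
def partitionFilter : Filter (Partition Ω) := ⨅ Δ : Gauge Ω, 𝓟 {P | P.Subordinate Δ}

lemma hasBasis_partitionFilter :
    (partitionFilter Ω).HasBasis (fun _ : Gauge Ω => True) fun Δ => {P | P.Subordinate Δ} :=
  hasBasis_iInf_principal fun Δ Δ' => ⟨Δ.inter Δ',
    fun _ hP i => (hP i).trans Set.inter_subset_left,
    fun _ hP i => (hP i).trans Set.inter_subset_right⟩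

instance [CompactSpace Ω] [OpensMeasurableSpace Ω] : (partitionFilter Ω).NeBot :=
  hasBasis_partitionFilter.neBot_iff.2 fun _ => exists_subordinate _

end Partition

/-! ### Estimates for McShane sums -/

section Sum

variable {Ω X : Type*} [MeasurableSpace Ω] [NormedAddCommGroup X] [NormedSpace ℝ X]

lemma isBounded_finsetSum {ι X : Type*} [SeminormedAddCommGroup X] (s : Finset ι) {A : ι → Set X}
    (hA : ∀ i, Bornology.IsBounded (A i)) : Bornology.IsBounded (∑ i ∈ s, A i) := by
  induction s using Finset.cons_induction with
  | empty => exact Bornology.isBounded_singleton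
  | cons i s hi ih => rw [Finset.sum_cons]; exact (hA i).add ih

lemma nonempty_finsetSum {ι X : Type*} [AddCommMonoid X] (s : Finset ι) {A : ι → Set X}
    (hA : ∀ i, (A i).Nonempty) : (∑ i ∈ s, A i).Nonempty := by
  induction s using Finset.cons_induction with
  | empty => simp
  | cons i s hi ih => rw [Finset.sum_cons]; exact (hA i).add ih

lemma hausdorffDist_finsetSum_le {ι X : Type*} [NormedAddCommGroup X] (s : Finset ι) {A B : ι → Set X}
    (hA : ∀ i, (A i).Nonempty) (hB : ∀ i, (B i).Nonempty)
    (bA : ∀ i, Bornology.IsBounded (A i)) (bB : ∀ i, Bornology.IsBounded (B i)) :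
    Metric.hausdorffDist (∑ i ∈ s, A i) (∑ i ∈ s, B i) ≤
      ∑ i ∈ s, Metric.hausdorffDist (A i) (B i) := by
  induction s using Finset.cons_induction with
  | empty => simp
  | cons i s hi ih =>
    simp only [Finset.sum_cons]
    exact (hausdorffDist_add_le (hA i) (hB i) (nonempty_finsetSum s hA) (nonempty_finsetSum s hB)
      (bA i) (bB i) (isBounded_finsetSum s bA) (isBounded_finsetSum s bB)).trans (by gcongr)

/-- The McShane sum as a bounded convex set. -/
def mcShaneSumConvex (Γ : Ω → ClosedBoundedConvex X) (μ : Measure Ω) (P : Partition Ω) :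
    BoundedConvex X where
  carrier := mcShaneSum Γ μ P
  nonempty := nonempty_finsetSum _ fun i => (Γ (P.tag i)).nonempty'.smul_set
  isBounded := isBounded_finsetSum _ fun i => (Γ (P.tag i)).isBounded'.smul₀ _
  convex := convex_sum _ fun i _ => (Γ (P.tag i)).convex'.smul _

lemma mcShaneSum_glue (Γ : Ω → ClosedBoundedConvex X) (μ : Measure Ω)
    (P Q : Partition Ω) {A : Set Ω} (hA : MeasurableSet A) :
    mcShaneSum Γ μ (P.glue Q hA) =
      mcShaneSum Γ (μ.restrict A) P + mcShaneSum Γ (μ.restrict Aᶜ) Q := by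
  simp only [mcShaneSum, measureReal_restrict_apply (P.measurable' _),
    measureReal_restrict_apply (Q.measurable' _)]
  change ∑ i : Fin (P.size + Q.size), _ = _
  rw [Fin.sum_univ_add]
  simp [Partition.glue]

/-- Both glued partitions use `P` off `A`, so their sums have the same second summand, which
cancels. -/
lemma dist_mcShaneSum_restrict_le (Γ : Ω → ClosedBoundedConvex X) (μ : Measure Ω)
    (P Q : Partition Ω) {A : Set Ω} (hA : MeasurableSet A) :
    dist (mcShaneSumConvex Γ (μ.restrict A) P) (mcShaneSumConvex Γ (μ.restrict A) Q) ≤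
      dist (mcShaneSumConvex Γ μ (P.glue P hA)) (mcShaneSumConvex Γ μ (Q.glue P hA)) := by
  simp only [BoundedConvex.dist_def, mcShaneSumConvex, mcShaneSum_glue]
  let S := fun (B : Set Ω) (R : Partition Ω) => mcShaneSumConvex Γ (μ.restrict B) R
  exact hausdorffDist_le_hausdorffDist_add_right (S A P).nonempty (S A Q).nonempty
    (S Aᶜ P).nonempty (S A P).isBounded (S A Q).isBounded (S Aᶜ P).isBounded (S A P).convex
    (S A Q).convex

lemma dist_mcShaneSum_le {Γ Γ' : Ω → ClosedBoundedConvex X} {μ ν : Measure Ω} (P : Partition Ω)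
    {M : Ω → ℝ} (hM : ∀ t, ∀ x ∈ (Γ' t : Set X), ‖x‖ ≤ M t) :
    dist (mcShaneSumConvex Γ μ P) (mcShaneSumConvex Γ' ν P) ≤
      ∑ i, (|μ.real (P.part i) - ν.real (P.part i)| * M (P.tag i) +
        μ.real (P.part i) * Metric.hausdorffDist (Γ (P.tag i) : Set X) (Γ' (P.tag i))) := by
  rw [BoundedConvex.dist_def]
  simp only [mcShaneSumConvex, mcShaneSum]
  refine (hausdorffDist_finsetSum_le Finset.univ (A := fun i => μ.real (P.part i) • (Γ (P.tag i) : Set X))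
    (B := fun i => ν.real (P.part i) • (Γ' (P.tag i) : Set X))
    (fun i => (Γ (P.tag i)).nonempty'.smul_set)
    (fun i => (Γ' (P.tag i)).nonempty'.smul_set) (fun i => (Γ (P.tag i)).isBounded'.smul₀ _)
    (fun i => (Γ' (P.tag i)).isBounded'.smul₀ _)).trans (Finset.sum_le_sum fun i _ => ?_)
  exact hausdorffDist_smul_le (Γ _).nonempty' (Γ' _).nonempty' (Γ _).isBounded' (Γ' _).isBounded'
    measureReal_nonneg (hM _)

end Sum

/-! ### Integrals as limits, and the Cauchy criterion -/

section Integral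

variable {Ω X : Type*} [TopologicalSpace Ω] [MeasurableSpace Ω]
  [NormedAddCommGroup X] [NormedSpace ℝ X]

lemma hasMcShaneIntegral_iff_tendsto {Γ : Ω → ClosedBoundedConvex X} {μ : Measure Ω}
    {I : ClosedBoundedConvex X} :
    HasMcShaneIntegral Γ μ I ↔
      Tendsto (mcShaneSumConvex Γ μ) (partitionFilter Ω) (𝓝 I.toBoundedConvex) := by
  rw [hasBasis_partitionFilter.tendsto_iff Metric.nhds_basis_ball]
  simp only [HasMcShaneIntegral, true_and, Metric.mem_ball', Set.mem_ofPred_eq]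
  rfl

lemma McShaneIntegrable.tendsto {Γ : Ω → ClosedBoundedConvex X} {μ : Measure Ω}
    (h : McShaneIntegrable Γ μ) :
    Tendsto (mcShaneSumConvex Γ μ) (partitionFilter Ω)
      (𝓝 (mcShaneIntegral Γ μ).toBoundedConvex) := by
  rw [mcShaneIntegral, dif_pos h]
  exact hasMcShaneIntegral_iff_tendsto.1 h.choose_spec

lemma EquiIntegrable.exists_gauge {Γs : ℕ → Ω → ClosedBoundedConvex X} {ms : ℕ → Measure Ω}
    (h : EquiIntegrable Γs ms) {ε : ℝ} (hε : 0 < ε) :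
    ∃ Δ : Gauge Ω, ∀ n, ∀ A : Set Ω, MeasurableSet A →
      ∀ P Q : Partition Ω, P.Subordinate Δ → Q.Subordinate Δ →
      dist (mcShaneSumConvex (Γs n) ((ms n).restrict A) P)
        (mcShaneSumConvex (Γs n) ((ms n).restrict A) Q) ≤ ε := by
  obtain ⟨Δ, hΔ⟩ := h.2 (ε / 2) (half_pos hε)
  refine ⟨Δ, fun n A hA P Q hP hQ => (dist_mcShaneSum_restrict_le _ _ P Q hA).trans ?_⟩
  have h1 : dist (mcShaneSumConvex (Γs n) (ms n) (P.glue P hA))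
    (mcShaneIntegral (Γs n) (ms n)).toBoundedConvex < ε / 2 := hΔ n _ (hP.glue hP hA)
  have h2 : dist (mcShaneSumConvex (Γs n) (ms n) (Q.glue P hA))
    (mcShaneIntegral (Γs n) (ms n)).toBoundedConvex < ε / 2 := hΔ n _ (hQ.glue hP hA)
  linarith [dist_triangle_right (mcShaneSumConvex (Γs n) (ms n) (P.glue P hA))
    (mcShaneSumConvex (Γs n) (ms n) (Q.glue P hA))
    (mcShaneIntegral (Γs n) (ms n)).toBoundedConvex]

variable [CompactSpace Ω] [OpensMeasurableSpace Ω]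

lemma mcShaneIntegrable_of_cauchy [CompleteSpace X] {Γ : Ω → ClosedBoundedConvex X}
    {μ : Measure Ω}
    (h : ∀ ε > 0, ∃ Δ : Gauge Ω, ∀ P Q : Partition Ω, P.Subordinate Δ → Q.Subordinate Δ →
      dist (mcShaneSumConvex Γ μ P) (mcShaneSumConvex Γ μ Q) ≤ ε) :
    McShaneIntegrable Γ μ := by
  have hc : Cauchy (map (mcShaneSumConvex Γ μ) (partitionFilter Ω)) := by
    refine Metric.cauchy_iff.2 ⟨inferInstance, fun ε hε => ?_⟩
    obtain ⟨Δ, hΔ⟩ := h (ε / 2) (half_pos hε)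
    refine ⟨_, image_mem_map (hasBasis_partitionFilter.mem_of_mem (i := Δ) trivial), ?_⟩
    rintro _ ⟨P, hP, rfl⟩ _ ⟨Q, hQ, rfl⟩
    exact (hΔ P Q hP hQ).trans_lt (half_lt_self hε)
  obtain ⟨I, hI⟩ := cauchy_map_iff_exists_tendsto.1 hc
  refine ⟨I.closure, hasMcShaneIntegral_iff_tendsto.2 ?_⟩
  -- The limit `I` may fail to be closed; its closure has the same neighbourhoods.
  rwa [← (Metric.inseparable_iff.2 I.dist_closure).nhds_eq]

/-- Let `Q` tend to the integral with `P` fixed: the Cauchy gauge already serves for the integral,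
so its uniformity is not lost. -/
lemma McShaneIntegrable.dist_sum_integral_le {Γ : Ω → ClosedBoundedConvex X} {μ : Measure Ω}
    (h : McShaneIntegrable Γ μ) {ε : ℝ} {Δ : Gauge Ω}
    (hΔ : ∀ P Q : Partition Ω, P.Subordinate Δ → Q.Subordinate Δ →
      dist (mcShaneSumConvex Γ μ P) (mcShaneSumConvex Γ μ Q) ≤ ε)
    {P : Partition Ω} (hP : P.Subordinate Δ) :
    dist (mcShaneSumConvex Γ μ P) (mcShaneIntegral Γ μ).toBoundedConvex ≤ ε := by
  refine le_of_tendsto (tendsto_const_nhds.dist h.tendsto) ?_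
  filter_upwards [hasBasis_partitionFilter.mem_of_mem (i := Δ) trivial] with Q hQ
  exact hΔ P Q hP hQ

end Integral

/-! ### Passage to the limit in measures and multifunctions -/

section Convergence

lemma ClosedBoundedConvex.exists_norm_bound {Ω X : Type*} [NormedAddCommGroup X] [NormedSpace ℝ X]
    (Γ : Ω → ClosedBoundedConvex X) : ∃ M : Ω → ℝ, ∀ t, ∀ x ∈ (Γ t : Set X), ‖x‖ ≤ M t := by
  choose M hM using fun t => isBounded_iff_forall_norm_le.1 (Γ t).isBounded'
  exact ⟨M, hM⟩

lemma TotalVariationTendsto.exists_bound {Ω : Type*} [MeasurableSpace Ω] {ms : ℕ → Measure Ω}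
    {m : Measure Ω} [∀ n, IsFiniteMeasure (ms n)] [IsFiniteMeasure m]
    (h : TotalVariationTendsto ms m) :
    ∃ δ : ℕ → ℝ, Tendsto δ atTop (𝓝 0) ∧
      ∀ n, ∀ A : Set Ω, MeasurableSet A → |(ms n).real A - m.real A| ≤ δ n := by
  refine ⟨fun n => (m.toSignedMeasure - (ms n).toSignedMeasure).totalVariation.real Set.univ,
    (ENNReal.tendsto_toReal ENNReal.zero_ne_top).comp h, fun n A hA => ?_⟩
  have := (m.toSignedMeasure - (ms n).toSignedMeasure).norm_le_totalVariation A
  rw [Measure.toSignedMeasure_sub_apply hA, Real.norm_eq_abs, abs_sub_comm] at this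
  exact this.trans (measureReal_mono (Set.subset_univ A))

lemma TotalVariationTendsto.setwiseTendsto {Ω : Type*} [MeasurableSpace Ω] {ms : ℕ → Measure Ω}
    {m : Measure Ω} [∀ n, IsFiniteMeasure (ms n)] [IsFiniteMeasure m]
    (h : TotalVariationTendsto ms m) : SetwiseTendsto ms m := by
  obtain ⟨δ, hδ, hb⟩ := h.exists_bound
  exact fun A hA => tendsto_iff_dist_tendsto_zero.2
    (squeeze_zero (fun _ => dist_nonneg) (fun n => hb n A hA) hδ)

variable {Ω X : Type*} [MeasurableSpace Ω] [NormedAddCommGroup X] [NormedSpace ℝ X]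
  {m : Measure Ω} {ms : ℕ → Measure Ω}
  {Γ : Ω → ClosedBoundedConvex X} {Γs : ℕ → Ω → ClosedBoundedConvex X}

lemma SetwiseTendsto.tendsto_dist_mcShaneSum (hm : SetwiseTendsto ms m)
    (hlim : ∀ t : Ω,
      Tendsto (fun n => Metric.hausdorffDist (Γs n t : Set X) (Γ t : Set X)) atTop (𝓝 0))
    {A : Set Ω} (hA : MeasurableSet A) (P : Partition Ω) :
    Tendsto (fun n => dist (mcShaneSumConvex (Γs n) ((ms n).restrict A) P)
      (mcShaneSumConvex Γ (m.restrict A) P)) atTop (𝓝 0) := by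
  obtain ⟨M, hM⟩ := ClosedBoundedConvex.exists_norm_bound Γ
  refine squeeze_zero (fun _ => dist_nonneg) (fun n => dist_mcShaneSum_le P hM) ?_
  have : (0 : ℝ) = ∑ i : Fin P.size, (|m.real (P.part i ∩ A) - m.real (P.part i ∩ A)| *
      M (P.tag i) + m.real (P.part i ∩ A) * 0) := by simp
  rw [this]
  simp only [measureReal_restrict_apply (P.measurable' _)]
  refine tendsto_finsetSum _ fun i _ => ?_
  have h := hm _ ((P.measurable' i).inter hA)
  exact ((h.sub_const _).abs.mul_const _).add (h.mul (hlim _))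

/-- Total variation bounds all the differences of measures by one `δ n`, and the weights are at most
the total mass, so `A` disappears from the bound. -/
lemma TotalVariationTendsto.exists_dist_mcShaneSum_le [∀ n, IsFiniteMeasure (ms n)]
    [IsFiniteMeasure m] (hm : TotalVariationTendsto ms m)
    (hlim : ∀ t : Ω,
      Tendsto (fun n => Metric.hausdorffDist (Γs n t : Set X) (Γ t : Set X)) atTop (𝓝 0))
    (P : Partition Ω) :
    ∃ η : ℕ → ℝ, Tendsto η atTop (𝓝 0) ∧ ∀ n, ∀ A : Set Ω, MeasurableSet A →
      dist (mcShaneSumConvex (Γs n) ((ms n).restrict A) P)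
        (mcShaneSumConvex Γ (m.restrict A) P) ≤ η n := by
  obtain ⟨M, hM⟩ := ClosedBoundedConvex.exists_norm_bound Γ
  obtain ⟨δ, hδ, hb⟩ := hm.exists_bound
  have hM0 : ∀ t, 0 ≤ M t := fun t => by
    obtain ⟨x, hx⟩ := (Γ t).nonempty'
    exact (norm_nonneg x).trans (hM t x hx)
  refine ⟨fun n => ∑ i : Fin P.size, (δ n * M (P.tag i) + (ms n).real Set.univ *
    Metric.hausdorffDist (Γs n (P.tag i) : Set X) (Γ (P.tag i))), ?_, fun n A hA => ?_⟩
  · have : (0 : ℝ) = ∑ i : Fin P.size, (0 * M (P.tag i) + m.real Set.univ * 0) := by simp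
    rw [this]
    exact tendsto_finsetSum _ fun i _ => (hδ.mul_const _).add
      ((hm.setwiseTendsto _ MeasurableSet.univ).mul (hlim _))
  · refine (dist_mcShaneSum_le P hM).trans (Finset.sum_le_sum fun i _ => ?_)
    simp only [measureReal_restrict_apply (P.measurable' _)]
    gcongr
    · exact hM0 _
    · exact hb n _ ((P.measurable' i).inter hA)
    · exact Metric.hausdorffDist_nonneg
    · exact measure_ne_top _ _
    · exact Set.subset_univ _

variable [TopologicalSpace Ω]

/-- For fixed `P`, `Q` and `A`, the closed inequality survives `n → ∞`, hence with the same gauge.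
-/
lemma EquiIntegrable.exists_gauge_limit (hequi : EquiIntegrable Γs ms)
    (hm : SetwiseTendsto ms m)
    (hlim : ∀ t : Ω,
      Tendsto (fun n => Metric.hausdorffDist (Γs n t : Set X) (Γ t : Set X)) atTop (𝓝 0))
    {ε : ℝ} (hε : 0 < ε) :
    ∃ Δ : Gauge Ω, ∀ A : Set Ω, MeasurableSet A →
      ∀ P Q : Partition Ω, P.Subordinate Δ → Q.Subordinate Δ →
      (∀ n, dist (mcShaneSumConvex (Γs n) ((ms n).restrict A) P)
        (mcShaneSumConvex (Γs n) ((ms n).restrict A) Q) ≤ ε) ∧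
      dist (mcShaneSumConvex Γ (m.restrict A) P) (mcShaneSumConvex Γ (m.restrict A) Q) ≤ ε := by
  obtain ⟨Δ, hΔ⟩ := hequi.exists_gauge hε
  refine ⟨Δ, fun A hA P Q hP hQ => ⟨fun n => hΔ n A hA P Q hP hQ, ?_⟩⟩
  have hP' := tendsto_iff_dist_tendsto_zero.2 (hm.tendsto_dist_mcShaneSum hlim hA P)
  have hQ' := tendsto_iff_dist_tendsto_zero.2 (hm.tendsto_dist_mcShaneSum hlim hA Q)
  exact le_of_tendsto (hP'.dist hQ') (Eventually.of_forall fun n => hΔ n A hA P Q hP hQ)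

variable [CompactSpace Ω] [OpensMeasurableSpace Ω] [CompleteSpace X]

lemma EquiIntegrable.integrableOn (hequi : EquiIntegrable Γs ms) {A : Set Ω}
    (hA : MeasurableSet A) (n : ℕ) : McShaneIntegrableOn (Γs n) A (ms n) :=
  mcShaneIntegrable_of_cauchy fun _ hε =>
    (hequi.exists_gauge hε).imp fun _ hΔ => hΔ n A hA

lemma EquiIntegrable.integrableOn_limit (hequi : EquiIntegrable Γs ms)
    (hm : SetwiseTendsto ms m)
    (hlim : ∀ t : Ω,
      Tendsto (fun n => Metric.hausdorffDist (Γs n t : Set X) (Γ t : Set X)) atTop (𝓝 0))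
    {A : Set Ω} (hA : MeasurableSet A) : McShaneIntegrableOn Γ A m :=
  mcShaneIntegrable_of_cauchy fun _ hε =>
    (hequi.exists_gauge_limit hm hlim hε).imp fun _ hΔ P Q hP hQ => (hΔ A hA P Q hP hQ).2

lemma EquiIntegrable.integrable_limit (hequi : EquiIntegrable Γs ms)
    (hm : SetwiseTendsto ms m)
    (hlim : ∀ t : Ω,
      Tendsto (fun n => Metric.hausdorffDist (Γs n t : Set X) (Γ t : Set X)) atTop (𝓝 0)) :
    McShaneIntegrable Γ m := by
  simpa [McShaneIntegrableOn] using hequi.integrableOn_limit hm hlim MeasurableSet.univ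

/-- The distance of the integrals over a set is controlled, uniformly in the set, by the distance
of the sums of one partition. -/
lemma EquiIntegrable.exists_partition (hequi : EquiIntegrable Γs ms)
    (hm : SetwiseTendsto ms m)
    (hlim : ∀ t : Ω,
      Tendsto (fun n => Metric.hausdorffDist (Γs n t : Set X) (Γ t : Set X)) atTop (𝓝 0))
    {ε : ℝ} (hε : 0 < ε) :
    ∃ P : Partition Ω, ∀ n, ∀ A : Set Ω, MeasurableSet A →
      Metric.hausdorffDist (mcShaneIntegralOn (Γs n) A (ms n) : Set X)
        (mcShaneIntegralOn Γ A m : Set X) ≤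
      ε + dist (mcShaneSumConvex (Γs n) ((ms n).restrict A) P)
        (mcShaneSumConvex Γ (m.restrict A) P) := by
  obtain ⟨Δ, hΔ⟩ := hequi.exists_gauge_limit hm hlim (half_pos hε)
  obtain ⟨P, hP⟩ := exists_subordinate Δ
  refine ⟨P, fun n A hA => ?_⟩
  have h1 := McShaneIntegrable.dist_sum_integral_le (hequi.integrableOn hA n)
    (fun P Q hP hQ => (hΔ A hA P Q hP hQ).1 n) hP
  have h2 := McShaneIntegrable.dist_sum_integral_le (hequi.integrableOn_limit hm hlim hA)
    (fun P Q hP hQ => (hΔ A hA P Q hP hQ).2) hP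
  have h3 := dist_triangle4 (mcShaneIntegral (Γs n) ((ms n).restrict A)).toBoundedConvex
    (mcShaneSumConvex (Γs n) ((ms n).restrict A) P) (mcShaneSumConvex Γ (m.restrict A) P)
    (mcShaneIntegral Γ (m.restrict A)).toBoundedConvex
  rw [dist_comm] at h1
  change dist (mcShaneIntegral (Γs n) ((ms n).restrict A)).toBoundedConvex
    (mcShaneIntegral Γ (m.restrict A)).toBoundedConvex ≤ _
  linarith

end Convergence

end McShane

/-! ### The convergence theorem -/

theorem theorem3p13 {Ω X : Type*} [TopologicalSpace Ω] [CompactSpace Ω]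
    [MeasurableSpace Ω] [OpensMeasurableSpace Ω]
    [NormedAddCommGroup X] [NormedSpace ℝ X] [CompleteSpace X]
    (m : Measure Ω) [IsFiniteMeasure m]
    (ms : ℕ → Measure Ω) [∀ n, IsFiniteMeasure (ms n)]
    (Γ : Ω → McShane.ClosedBoundedConvex X) (Γs : ℕ → Ω → McShane.ClosedBoundedConvex X)
    (hint : ∀ n, McShane.McShaneIntegrable (Γs n) (ms n))
    (hequi : McShane.EquiIntegrable Γs ms)
    (hlim : ∀ t : Ω,
      Tendsto (fun n => Metric.hausdorffDist (Γs n t : Set X) (Γ t : Set X)) atTop (𝓝 0)) :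
    (McShane.SetwiseTendsto ms m →
      McShane.McShaneIntegrable Γ m ∧
      ∀ A : Set Ω, MeasurableSet A →
        (∀ n, McShane.McShaneIntegrableOn (Γs n) A (ms n)) ∧
        McShane.McShaneIntegrableOn Γ A m ∧
        Tendsto (fun n => Metric.hausdorffDist
          (McShane.mcShaneIntegralOn (Γs n) A (ms n) : Set X)
          (McShane.mcShaneIntegralOn Γ A m : Set X)) atTop (𝓝 0)) ∧
    (McShane.TotalVariationTendsto ms m →
      McShane.McShaneIntegrable Γ m ∧
      (∀ A : Set Ω, MeasurableSet A →
        (∀ n, McShane.McShaneIntegrableOn (Γs n) A (ms n)) ∧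
        McShane.McShaneIntegrableOn Γ A m) ∧
      ∀ ε : ℝ, 0 < ε → ∃ N : ℕ, ∀ n, N ≤ n → ∀ A : Set Ω, MeasurableSet A →
        Metric.hausdorffDist
          (McShane.mcShaneIntegralOn (Γs n) A (ms n) : Set X)
          (McShane.mcShaneIntegralOn Γ A m : Set X) < ε) := by
  refine ⟨fun hm => ⟨hequi.integrable_limit hm hlim, fun A hA => ⟨hequi.integrableOn hA,
    hequi.integrableOn_limit hm hlim hA, ?_⟩⟩, fun hTV => ?_⟩
  · refine tendsto_order.2 ⟨fun a ha => Eventually.of_forall fun _ =>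
      ha.trans_le Metric.hausdorffDist_nonneg, fun ε hε => ?_⟩
    obtain ⟨P, hP⟩ := hequi.exists_partition hm hlim (half_pos hε)
    filter_upwards [(hm.tendsto_dist_mcShaneSum hlim hA P).eventually_lt_const (half_pos hε)]
      with n hn
    linarith [hP n A hA]
  · have hm := hTV.setwiseTendsto
    refine ⟨hequi.integrable_limit hm hlim, fun A hA => ⟨hequi.integrableOn hA,
      hequi.integrableOn_limit hm hlim hA⟩, fun ε hε => ?_⟩
    -- Both `P` and the bound `η` are fixed before `A`, which makes `N` uniform.
    obtain ⟨P, hP⟩ := hequi.exists_partition hm hlim (half_pos hε)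
    obtain ⟨η, hη, hb⟩ := hTV.exists_dist_mcShaneSum_le hlim P
    obtain ⟨N, hN⟩ := eventually_atTop.1 (hη.eventually_lt_const (half_pos hε))
    exact ⟨N, fun n hn A hA => by linarith [hP n A hA, hb n A hA, hN n hn]⟩
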